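/- Let $P$ be a finite set of points in the Euclidean plane. The $L_\infty$-Delaunay triangulation of $P$ (respectively the $L_1$-Delaunay triangulation of $P$) is the graph with vertex set $P$ in which two distinct points $u,v\in P$ are adjacent if and only if there is a non-degenerate square with sides parallel to the coordinate axes (respectively a non-degenerate tipped square, i.e. a square whose sides have slopes $\pm 1$) that has $u$ and $v$ on its boundary and contains no point of $P$ in its interior. Each edge is weighted by its Euclidean length. The stretch factor of a graph $H$ on $P$ is the least $t\in[0,\infty]$ such that for all $u,v\in P$ the length of a shortest path from $u$ to $v$ in $H$ ($\infty$ if there is none) is at most $t$ times the Euclidean distance of $u$ and $v$. (i) If no four points of $P$ lie on the boundary of an axis-parallel square and no two points of $P$ have the same abscissa or the same ordinate, then the stretch factor of the $L_\infty$-Delaunay triangulation of $P$ is at most $\sqrt{4+2\sqrt2}$. (ii) If no four points of $P$ lie on the boundary of a tipped square and no two points of $P$ lie on a common line of slope $1$ or $-1$, then the stretch factor of the $L_1$-Delaunay triangulation of $P$ is at most $\sqrt{4+2\sqrt2}$. -/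

import Mathlib

open scoped ENNReal

namespace SquareDelaunay

/-- The Euclidean plane; `dist` and `edist` on it are the Euclidean distance. -/
abbrev Plane : Type := EuclideanSpace ℝ (Fin 2)

/-- The `L_∞`-distance `max {d_x, d_y}`. -/
noncomputable def distInf (u w : Plane) : ℝ := max |u 0 - w 0| |u 1 - w 1|

/-- The `L_1`-distance `d_x + d_y`. -/
noncomputable def distOne (u w : Plane) : ℝ := |u 0 - w 0| + |u 1 - w 1|

/-- The boundary of the square with centre `c` and size `r`: for `d = distInf` this is the boundary
of the axis-parallel square of side `2 * r`, for `d = distOne` that of the square tipped at 45°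
whose diagonals have length `2 * r`. -/
def squareBoundary (d : Plane → Plane → ℝ) (c : Plane) (r : ℝ) : Set Plane := {p | d p c = r}

/-- The interior of the same square. -/
def squareInterior (d : Plane → Plane → ℝ) (c : Plane) (r : ℝ) : Set Plane := {p | d p c < r}

/-- The graph on `P` in which two distinct points are adjacent iff some (nondegenerate) square has
both on its boundary and no point of `P` in its interior. -/
def delaunay (d : Plane → Plane → ℝ) (P : Finset Plane) : SimpleGraph P where
  Adj u v := u ≠ v ∧ ∃ (c : Plane) (r : ℝ), 0 < r ∧
    (u : Plane) ∈ squareBoundary d c r ∧ (v : Plane) ∈ squareBoundary d c r ∧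
    ∀ w ∈ P, w ∉ squareInterior d c r
  symm := ⟨fun _ _ ⟨hne, c, r, hr, hu, hv, hw⟩ => ⟨hne.symm, c, r, hr, hv, hu, hw⟩⟩
  loopless := ⟨fun _ h => h.1 rfl⟩

/-- The `L_∞`-Delaunay triangulation (axis-parallel squares). -/
noncomputable def delaunayInf (P : Finset Plane) : SimpleGraph P := delaunay distInf P

/-- The `L_1`-Delaunay triangulation (tipped squares). -/
noncomputable def delaunayOne (P : Finset Plane) : SimpleGraph P := delaunay distOne P

/-- No four points of `P` lie on the boundary of a square. -/
def NoFourOnSquare (d : Plane → Plane → ℝ) (P : Finset Plane) : Prop :=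
  ∀ Q : Finset Plane, Q ⊆ P → Q.card = 4 →
    ∀ (c : Plane) (r : ℝ), 0 < r → ¬ ((Q : Set Plane) ⊆ squareBoundary d c r)

/-- General position for the `L_∞`-Delaunay triangulation: no four points on the boundary of an
axis-parallel square, no two points with the same abscissa or the same ordinate. -/
def GeneralPositionInf (P : Finset Plane) : Prop :=
  NoFourOnSquare distInf P ∧
    ∀ u ∈ P, ∀ v ∈ P, u ≠ v → u 0 ≠ v 0 ∧ u 1 ≠ v 1

/-- General position for the `L_1`-Delaunay triangulation (the same condition turned by 45°): no
four points on the boundary of a tipped square, no two points on a line of slope `1` or `-1`. -/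
def GeneralPositionOne (P : Finset Plane) : Prop :=
  NoFourOnSquare distOne P ∧
    ∀ u ∈ P, ∀ v ∈ P, u ≠ v → u 0 + u 1 ≠ v 0 + v 1 ∧ u 0 - u 1 ≠ v 0 - v 1

/-- Euclidean length of a walk in a graph on `P`. -/
noncomputable def walkLength {P : Finset Plane} {G : SimpleGraph P} {u v : P}
    (p : G.Walk u v) : ℝ≥0∞ :=
  (p.darts.map fun e => edist (e.fst : Plane) (e.snd : Plane)).sum

/-- Distance in `G`, edges weighted by Euclidean length; it is `∞` if no walk joins `u` and `v`. -/
noncomputable def graphDist {P : Finset Plane} (G : SimpleGraph P) (u v : P) : ℝ≥0∞ :=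
  ⨅ p : G.Walk u v, walkLength p

/-- `H` is a `t`-spanner of `G`. -/
def IsSpannerOf {P : Finset Plane} (H G : SimpleGraph P) (t : ℝ≥0∞) : Prop :=
  H ≤ G ∧ ∀ u v : P, graphDist H u v ≤ t * graphDist G u v

/-- The stretch factor of `H` with respect to the complete Euclidean graph `⊤`: the least `t`
such that `H` is a `t`-spanner of it. -/
noncomputable def stretchFactor {P : Finset Plane} (H : SimpleGraph P) : ℝ≥0∞ :=
  sInf {t : ℝ≥0∞ | IsSpannerOf H ⊤ t}

end SquareDelaunay

/-!
The path bound `|x u - x v| + |y u - y v| + √2 * max |x u - x v| |y u - y v|` is proved by induction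
on the `L_∞`-distance of two points `a` and `b`, say with `a` on the left and with horizontal
distance at least as large as the vertical one; the Cauchy–Schwarz inequality then gives the factor
`√(4 + 2 * √2)`.

If the rectangle spanned by `a` and `b` contains a third point, a path is composed of shorter ones.
Otherwise every point between `a` and `b` horizontally lies above or below the rectangle. An empty
square with a point `h` above and a point `l` below it on its boundary moves from `a` to the right.
The lengths of the paths found to `h` and `l`, together with the part of the boundary of the square
from `h` to `l` through its right side, stay at most `4 * (e - x a)`, where `e` is the abscissa of
that side. So when the square reaches `b`, the shorter path has length at most `2 * (x b - x a)`.
When before that the segment from `h` to `l` gets slope at most `1`, its edge costs only `√2` times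
the horizontal progress, and the saving pays for a descent to `b`.

The diamonds of the `L_1`-distance become axis-parallel squares in coordinates turned by 45°.
-/

namespace SquareDelaunay

/-! ### Distances in a weighted graph -/

section GraphDist

variable {P : Finset Plane} {G : SimpleGraph P}

lemma walkLength_append {u v w : P} (p : G.Walk u v) (q : G.Walk v w) :
    walkLength (p.append q) = walkLength p + walkLength q := by
  simp [walkLength]

lemma walkLength_reverse {u v : P} (p : G.Walk u v) : walkLength p.reverse = walkLength p := by
  simp [walkLength, Function.comp_def, edist_comm]

lemma edist_le_walkLength {u v : P} (p : G.Walk u v) :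
    edist (u : Plane) (v : Plane) ≤ walkLength p := by
  induction p with
  | nil => simp
  | cons h p ih =>
    simp only [walkLength, SimpleGraph.Walk.darts_cons, List.map_cons, List.sum_cons] at ih ⊢
    exact (edist_triangle _ _ _).trans (add_le_add le_rfl ih)

lemma graphDist_self (u : P) : graphDist G u u = 0 :=
  le_antisymm (iInf_le_of_le .nil (by simp [walkLength])) zero_le

lemma graphDist_comm (u v : P) : graphDist G u v = graphDist G v u := by
  have graphDist_le (u v : P) : graphDist G u v ≤ graphDist G v u :=
    le_iInf fun p => (iInf_le _ p.reverse).trans (walkLength_reverse p).le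
  exact le_antisymm (graphDist_le u v) (graphDist_le v u)

lemma graphDist_triangle (u v w : P) : graphDist G u w ≤ graphDist G u v + graphDist G v w :=
  ENNReal.le_iInf_add_iInf fun p q => (iInf_le _ (p.append q)).trans (walkLength_append p q).le

lemma graphDist_le_edist_of_adj {u v : P} (h : G.Adj u v) :
    graphDist G u v ≤ edist (u : Plane) (v : Plane) :=
  iInf_le_of_le h.toWalk (by simp [walkLength])

lemma edist_le_graphDist (u v : P) : edist (u : Plane) (v : Plane) ≤ graphDist G u v :=
  le_iInf edist_le_walkLength

lemma stretchFactor_le_of_graphDist_le {t : ℝ≥0∞}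
    (h : ∀ u v : P, graphDist G u v ≤ t * edist (u : Plane) (v : Plane)) : stretchFactor G ≤ t :=
  sInf_le ⟨le_top, fun u v => (h u v).trans (mul_le_mul_right (edist_le_graphDist u v) t)⟩

end GraphDist

/-! ### Empty squares -/

section EmptySquare

variable {X : Type*} {x y : X → ℝ} {w e s n : ℝ} {p : X}

/-- No point of `X`, placed in the plane by the coordinates `x` and `y`, lies in the open rectangle
`(w, e) × (s, n)`. -/
def EmptyBox (x y : X → ℝ) (w e s n : ℝ) : Prop :=
  ∀ q, w < x q → x q < e → s < y q → ¬ y q < n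

/-- The rectangle `[w, e] × [s, n]` is a non-degenerate square without a point in its interior. -/
structure EmptySquare (x y : X → ℝ) (w e s n : ℝ) : Prop where
  lt : w < e
  side_eq : e - w = n - s
  empty : EmptyBox x y w e s n

/-- The point `p` lies on the boundary of the rectangle `[w, e] × [s, n]`. -/
def OnBoundary (x y : X → ℝ) (w e s n : ℝ) (p : X) : Prop :=
  (w ≤ x p ∧ x p ≤ e) ∧ (s ≤ y p ∧ y p ≤ n) ∧ (x p = w ∨ x p = e ∨ y p = s ∨ y p = n)

lemma EmptyBox.mono {w' e' s' n' : ℝ} (h : EmptyBox x y w e s n) (hw : w ≤ w') (he : e' ≤ e)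
    (hs : s ≤ s') (hn : n' ≤ n) : EmptyBox x y w' e' s' n' :=
  fun q hqw hqe hqs hqn => h q (by linarith) (by linarith) (by linarith) (by linarith)

lemma EmptyBox.neg_snd (h : EmptyBox x y w e s n) : EmptyBox x (-y) w e (-n) (-s) :=
  fun q hw he hs hn => h q hw he (neg_lt_neg_iff.mp hn) (neg_lt_neg_iff.mp hs)

lemma EmptyBox.swap (h : EmptyBox x y w e s n) : EmptyBox y x s n w e :=
  fun q hs hn hw he => h q hw he hs hn

lemma EmptySquare.neg_snd (h : EmptySquare x y w e s n) : EmptySquare x (-y) w e (-n) (-s) :=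
  ⟨h.lt, by linarith [h.side_eq], h.empty.neg_snd⟩

lemma EmptySquare.swap (h : EmptySquare x y w e s n) : EmptySquare y x s n w e :=
  ⟨by linarith [h.lt, h.side_eq], h.side_eq.symm, h.empty.swap⟩

namespace OnBoundary

lemma neg_snd (h : OnBoundary x y w e s n p) : OnBoundary x (-y) w e (-n) (-s) p := by
  simp only [OnBoundary, Pi.neg_apply, neg_le_neg_iff, neg_inj] at *
  tauto

lemma swap (h : OnBoundary x y w e s n p) : OnBoundary y x s n w e p := by
  simp only [OnBoundary] at *
  tauto

lemma of_left (hp : x p = w) (hwe : w ≤ e) (hs : s ≤ y p) (hn : y p ≤ n) :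
    OnBoundary x y w e s n p :=
  ⟨⟨hp.ge, hp.trans_le hwe⟩, ⟨hs, hn⟩, .inl hp⟩

lemma of_right (hp : x p = e) (hwe : w ≤ e) (hs : s ≤ y p) (hn : y p ≤ n) :
    OnBoundary x y w e s n p :=
  ⟨⟨hwe.trans hp.ge, hp.le⟩, ⟨hs, hn⟩, .inr (.inl hp)⟩

lemma of_bottom (hp : y p = s) (hsn : s ≤ n) (hw : w ≤ x p) (he : x p ≤ e) :
    OnBoundary x y w e s n p :=
  (of_left hp hsn hw he).swap

lemma of_top (hp : y p = n) (hsn : s ≤ n) (hw : w ≤ x p) (he : x p ≤ e) :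
    OnBoundary x y w e s n p :=
  (of_right hp hsn hw he).swap

end OnBoundary

/-- Growing a square with lower left corner `(w, s)` until it hits a point. -/
lemma exists_emptySquare_of_quadrant [Finite X] (h : ∃ q, w < x q ∧ s < y q) :
    ∃ q d, (w < x q ∧ s < y q) ∧ d = max (x q - w) (y q - s) ∧
      EmptySquare x y w (w + d) s (s + d) ∧
      ∀ q', w < x q' → s < y q' → d ≤ max (x q' - w) (y q' - s) := by
  obtain ⟨q, ⟨hqw, hqs⟩, hq_min⟩ := Set.exists_min_image {q | w < x q ∧ s < y q}
    (fun q => max (x q - w) (y q - s)) (Set.toFinite _) h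
  have hd : 0 < max (x q - w) (y q - s) := lt_max_of_lt_left (sub_pos.mpr hqw)
  refine ⟨q, _, ⟨hqw, hqs⟩, rfl, ⟨by linarith, by ring, ?_⟩, fun q' hw hs => hq_min q' ⟨hw, hs⟩⟩
  intro q' hw he hs hn
  exact (max_lt (sub_lt_iff_lt_add'.mpr he) (sub_lt_iff_lt_add'.mpr hn)).not_ge
    (hq_min q' ⟨hw, hs⟩)

end EmptySquare

/-! ### Path bounds -/

/-- Points without two on a horizontal or vertical line, together with a relation `D u v r` to be
read as "some path from `u` to `v` has length at most `r`"; two points on the boundary of an empty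
square are joined by an edge, weighted by the Euclidean distance. Keeping `D` abstract makes the
notion invariant under the symmetries of the square. -/
structure Net {X : Type*} (x y : X → ℝ) (D : X → X → ℝ → Prop) : Prop where
  injective_fst : Function.Injective x
  injective_snd : Function.Injective y
  self (u : X) : D u u 0
  mono {u v : X} {r r' : ℝ} : D u v r → r ≤ r' → D u v r'
  symm {u v : X} {r : ℝ} : D u v r → D v u r
  trans {u v w : X} {r r' : ℝ} : D u v r → D v w r' → D u w (r + r')
  edge {u v : X} {w e s n : ℝ} : EmptySquare x y w e s n →
    OnBoundary x y w e s n u → OnBoundary x y w e s n v → D u v √((x u - x v) ^ 2 + (y u - y v) ^ 2)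

variable {X : Type*} {x y : X → ℝ} {D : X → X → ℝ → Prop} {a b h l u v : X}

namespace Net

lemma neg_snd (N : Net x y D) : Net x (-y) D where
  __ := N
  injective_snd := neg_injective.comp N.injective_snd
  edge {u v _ _ _ _} S hu hv := by
    have hD := N.edge (by simpa only [neg_neg] using S.neg_snd)
      (by simpa only [neg_neg] using hu.neg_snd) (by simpa only [neg_neg] using hv.neg_snd)
    rwa [Pi.neg_apply, Pi.neg_apply, neg_sub_neg, ← neg_sub (y u), neg_sq]

lemma swap (N : Net x y D) : Net y x D where
  __ := N
  injective_fst := N.injective_snd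
  injective_snd := N.injective_fst
  edge S hu hv := by
    rw [add_comm]
    exact N.edge S.swap hu.swap hv.swap

lemma neg (N : Net x y D) : Net (-x) (-y) D :=
  N.swap.neg_snd.swap.neg_snd

section Edge

variable {w e s n : ℝ}

lemma edge_right (N : Net x y D) (S : EmptySquare x y w e s n)
    (hu : OnBoundary x y w e s n u) (hv : OnBoundary x y w e s n v) (hx : x u ≤ x v) :
    D u v (x v - x u + |y v - y u|) := by
  refine N.mono (N.edge S hu hv) (Real.sqrt_le_iff.mpr ⟨by grind, ?_⟩)
  rw [abs_sub_comm, add_sq, sq_abs]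
  nlinarith [mul_nonneg (sub_nonneg.mpr hx) (abs_nonneg (y u - y v))]

lemma edge_up (N : Net x y D) (S : EmptySquare x y w e s n)
    (hu : OnBoundary x y w e s n u) (hv : OnBoundary x y w e s n v)
    (hx : x u ≤ x v) (hy : y u ≤ y v) :
    D u v (x v - x u + (y v - y u)) := by
  simpa only [abs_of_nonneg (sub_nonneg.mpr hy)] using N.edge_right S hu hv hx

lemma edge_down (N : Net x y D) (S : EmptySquare x y w e s n)
    (hu : OnBoundary x y w e s n u) (hv : OnBoundary x y w e s n v)
    (hx : x u ≤ x v) (hy : y v ≤ y u) :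
    D u v (x v - x u + (y u - y v)) := by
  simpa only [abs_of_nonpos (sub_nonpos.mpr hy), neg_sub] using N.edge_right S hu hv hx

lemma edge_gentle (N : Net x y D) (S : EmptySquare x y w e s n)
    (hu : OnBoundary x y w e s n u) (hv : OnBoundary x y w e s n v) (h : |y v - y u| ≤ x v - x u) :
    D u v (√2 * (x v - x u)) := by
  have hx : 0 ≤ x v - x u := (abs_nonneg _).trans h
  refine N.mono (N.edge S hu hv) (Real.sqrt_le_iff.mpr ⟨by positivity, ?_⟩)
  rw [mul_pow, Real.sq_sqrt zero_le_two]
  linarith [sq_le_sq' (abs_le.mp h).1 (abs_le.mp h).2, sub_sq_comm (x u) (x v),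
    sub_sq_comm (y u) (y v)]

end Edge

end Net

/-- The bound on the length of a shortest path from `u` to `v` that the induction on their
`L_∞`-distance proves. -/
noncomputable def pathBound (x y : X → ℝ) (u v : X) : ℝ :=
  |x u - x v| + |y u - y v| + √2 * max |x u - x v| |y u - y v|

lemma pathBound_comm : pathBound x y u v = pathBound x y v u := by
  rw [pathBound, pathBound, abs_sub_comm (x u), abs_sub_comm (y u)]

lemma pathBound_swap : pathBound y x u v = pathBound x y u v := by
  rw [pathBound, pathBound, add_comm |y u - y v|, max_comm]

lemma pathBound_neg_snd : pathBound x (-y) u v = pathBound x y u v := by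
  rw [pathBound, pathBound, Pi.neg_apply, Pi.neg_apply, neg_sub_neg, abs_sub_comm (y v)]

lemma pathBound_of_abs_le (h : |y v - y u| ≤ x v - x u) :
    pathBound x y u v = (1 + √2) * (x v - x u) + |y v - y u| := by
  rw [pathBound, abs_sub_comm, abs_sub_comm (y u), abs_of_nonneg ((abs_nonneg _).trans h),
    max_eq_left h]
  ring

/-- The path bound holds for all pairs of points at `L_∞`-distance less than `δ`. -/
def PathBoundBelow (x y : X → ℝ) (D : X → X → ℝ → Prop) (δ : ℝ) : Prop :=
  ∀ u v, |x u - x v| < δ → |y u - y v| < δ → D u v (pathBound x y u v)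

lemma PathBoundBelow.neg_snd {δ : ℝ} (h : PathBoundBelow x y D δ) : PathBoundBelow x (-y) D δ := by
  intro u v hx hy
  rw [pathBound_neg_snd]
  rw [Pi.neg_apply, Pi.neg_apply, neg_sub_neg, abs_sub_comm] at hy
  exact h u v hx hy

lemma PathBoundBelow.swap {δ : ℝ} (h : PathBoundBelow x y D δ) : PathBoundBelow y x D δ := by
  intro u v hy hx
  rw [pathBound_swap]
  exact h u v hx hy

/-! ### Corridors -/

/-- The point `q` lies strictly between `a` and `b` horizontally, and above both of them. -/
structure Above (x y : X → ℝ) (a b q : X) : Prop where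
  west : x a < x q
  east : x q < x b
  left : y a < y q
  right : y b < y q

/-- The point `q` lies strictly between `a` and `b` horizontally, and below both of them. -/
structure Below (x y : X → ℝ) (a b q : X) : Prop where
  west : x a < x q
  east : x q < x b
  left : y q < y a
  right : y q < y b

lemma Above.neg_snd {q : X} (h : Above x y a b q) : Below x (-y) a b q :=
  ⟨h.west, h.east, neg_lt_neg h.left, neg_lt_neg h.right⟩

lemma Below.neg_snd {q : X} (h : Below x y a b q) : Above x (-y) a b q :=
  ⟨h.west, h.east, neg_lt_neg h.left, neg_lt_neg h.right⟩

/-- The points `a` and `b` span a rectangle that is at least as wide as high and contains no further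
point, and the path bound is known for all pairs that are closer than `a` and `b`. -/
structure Corridor (x y : X → ℝ) (D : X → X → ℝ → Prop) (a b : X) : Prop where
  net : Net x y D
  lt : x a < x b
  slope : |y b - y a| ≤ x b - x a
  sides (q : X) : x a < x q → x q < x b → Above x y a b q ∨ Below x y a b q
  ih : PathBoundBelow x y D (x b - x a)

/-- The path bound for the end points of a corridor. -/
noncomputable def corridorBound (x y : X → ℝ) (a b : X) : ℝ := (1 + √2) * (x b - x a) + |y b - y a|

lemma corridorBound_neg_snd : corridorBound x (-y) a b = corridorBound x y a b := by
  rw [corridorBound, corridorBound, Pi.neg_apply, Pi.neg_apply, neg_sub_neg, abs_sub_comm (y a)]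

lemma Corridor.neg_snd (C : Corridor x y D a b) : Corridor x (-y) D a b where
  net := C.net.neg_snd
  lt := C.lt
  slope := by
    rw [Pi.neg_apply, Pi.neg_apply, neg_sub_neg, abs_sub_comm]
    exact C.slope
  sides q ha hb := (C.sides q ha hb).symm.imp Below.neg_snd Above.neg_snd
  ih := C.ih.neg_snd

lemma two_mul_add_abs_le_corridorBound (h : x a ≤ x b) :
    2 * (x b - x a) + |y b - y a| ≤ corridorBound x y a b := by
  rw [corridorBound]
  nlinarith [Real.one_lt_sqrt_two]

lemma exists_or_of_ascent {α : Type*} [Finite α] {p : α → Prop} {goal : Prop} (f : α → ℝ)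
    (hp : ∃ i, p i) (ascent : ∀ i, p i → goal ∨ ∃ j, p j ∧ f i < f j) : goal := by
  obtain ⟨i, hi, hi_max⟩ := Set.exists_max_image {i | p i} f (Set.toFinite _) hp
  exact (ascent i hi).resolve_right fun ⟨j, hj, hij⟩ => (hi_max j hj).not_gt hij

/-! ### Descending to the end of a corridor -/

/-- The point `h` above the corridor is reached by a path short enough to afford descending to `b`
along the top sides of squares; the square of which `h` is the top right corner is empty above the
level of `b`. -/
structure Descent (x y : X → ℝ) (D : X → X → ℝ → Prop) (a b h : X) : Prop where
  above : Above x y a b h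
  empty : EmptyBox x y (x h - (y h - y b)) (x h) (y b) (y h)
  path : D a h ((1 + √2) * (x h - x a) - (y h - y a))

namespace Descent

lemma path_of_gentle (C : Corridor x y D a b) (H : Descent x y D a b h)
    (gentle : y h - y b ≤ x b - x h) : D a b (corridorBound x y a b) := by
  have hy : |y b - y h| = y h - y b := by grind [H.above.right]
  have path_hb : D h b (pathBound x y h b) := C.ih h b (by grind [H.above.west, H.above.east])
    (by grind [H.above.west])
  rw [pathBound_of_abs_le (hy.trans_le gentle), hy] at path_hb
  refine C.net.mono (C.net.trans H.path path_hb) ?_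
  rw [corridorBound]
  linarith [neg_abs_le (y b - y a)]

lemma path_or_exists_of_steep [Finite X] (C : Corridor x y D a b) (H : Descent x y D a b h)
    (steep : x b - x h < y h - y b) :
    D a b (corridorBound x y a b) ∨ ∃ p, Descent x y D a b p ∧ x h < x p := by
  obtain ⟨p, ⟨hp_west, hp_low, hp_high⟩, hp_min⟩ := Set.exists_min_image
    {q | x h < x q ∧ y b ≤ y q ∧ y q ≤ y h} x (Set.toFinite _)
    ⟨b, H.above.east, le_rfl, H.above.right.le⟩
  have hpb : x p ≤ x b := hp_min b ⟨H.above.east, le_rfl, H.above.right.le⟩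
  have hph : y p < y h := hp_high.lt_of_ne (C.net.injective_snd.ne (by grind))
  have empty : EmptyBox x y (x h - (y h - y b)) (x p) (y b) (y h) := by
    intro q hw he hs hn
    rcases lt_trichotomy (x q) (x h) with hqh | hqh | hqh
    · exact H.empty q hw hqh hs hn
    · exact hn.ne (congrArg y (C.net.injective_fst hqh))
    · exact he.not_ge (hp_min q ⟨hqh, hs.le, hn.le⟩)
  obtain ⟨d, hd⟩ : ∃ d, d = max (y h - y p) (x p - x h) := ⟨_, rfl⟩
  have S : EmptySquare x y (x p - d) (x p) (y h - d) (y h) :=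
    ⟨by grind, by ring, empty.mono (by grind) le_rfl (by grind) le_rfl⟩
  have path_p : D a p ((1 + √2) * (x h - x a) - (y h - y a) + (x p - x h + (y h - y p))) :=
    C.net.trans H.path (C.net.edge_down S (.of_top rfl (by grind) (by grind) (by grind))
      (.of_right rfl (by grind) (by grind) (by grind)) hp_west.le hph.le)
  rcases eq_or_ne p b with rfl | hne
  · refine .inl (C.net.mono path_p ?_)
    rw [corridorBound]
    nlinarith [neg_abs_le (y p - y a), Real.one_lt_sqrt_two]
  · have hpb' : x p < x b := hpb.lt_of_ne (C.net.injective_fst.ne hne)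
    have hyp : y b < y p := hp_low.lt_of_ne (C.net.injective_snd.ne hne.symm)
    refine .inr ⟨p, ⟨?_, empty.mono (by linarith) le_rfl le_rfl hph.le, ?_⟩, hp_west⟩
    · exact (C.sides p (H.above.west.trans hp_west) hpb').resolve_right
        fun hp => hp.right.not_gt hyp
    · exact C.net.mono path_p (by nlinarith [Real.one_lt_sqrt_two])

end Descent

namespace Corridor

lemma path_of_descent [Finite X] (C : Corridor x y D a b) (H : Descent x y D a b h) :
    D a b (corridorBound x y a b) := by
  refine exists_or_of_ascent x ⟨h, H⟩ fun p hp => ?_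
  rcases le_or_gt (y p - y b) (x b - x p) with gentle | steep
  · exact .inl (hp.path_of_gentle C gentle)
  · exact hp.path_or_exists_of_steep C steep

/-- A gentle edge costs only `√2` times the horizontal progress, which saves enough to descend. -/
lemma path_of_gentle [Finite X] {r w e s n : ℝ} (C : Corridor x y D a b) (hh : Above x y a b h)
    (hl : Below x y a b l) (S : EmptySquare x y w e s n) (hhS : OnBoundary x y w e s n h)
    (hlS : OnBoundary x y w e s n l) (gentle : y h - y l ≤ x h - x l) (path_l : D a l r)
    (hr : r ≤ 2 * (x l - x a) + (y a - y l)) : D a b (corridorBound x y a b) := by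
  have path_h : D l h (√2 * (x h - x l)) :=
    C.net.edge_gentle S hlS hhS (by grind [hh.right, hl.right])
  refine C.path_of_descent ⟨hh, S.empty.mono ?_ hhS.1.2 ?_ hhS.2.1.2,
    C.net.mono (C.net.trans path_l path_h) ?_⟩
  · grind [hl.right, hlS.1]
  · grind [hl.right, hlS.2.1]
  · nlinarith [Real.one_lt_sqrt_two, hl.west]

end Corridor

/-! ### Moving a front through a corridor -/

/-- The points `h` and `l` lie above and below the corridor from `a` to `b`, on the top and bottom
sides of a square that is empty and whose right side has abscissa `e`; paths of length `r` and `r'`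
lead from `a` to `h` and `l`. The `potential` adds to these lengths that of the boundary of the
square from `h` to `l` through its right side. -/
structure Front (x y : X → ℝ) (D : X → X → ℝ → Prop) (a b h l : X) (e r r' : ℝ) : Prop where
  above : Above x y a b h
  below : Below x y a b l
  east_le : e ≤ x b
  north : x h ∈ Set.Icc (e - (y h - y l)) e
  south : x l ∈ Set.Icc (e - (y h - y l)) e
  empty : EmptyBox x y (e - (y h - y l)) e (y l) (y h)
  path_north : D a h r
  path_south : D a l r'
  potential : r + r' + ((e - x h) + (y h - y l) + (e - x l)) ≤ 4 * (e - x a)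
  north_le : r ≤ 2 * (x h - x a) + (y h - y a)
  south_le : r' ≤ 2 * (x l - x a) + (y a - y l)

/-- Either the corridor can be crossed within its bound, or there is a front whose points have
abscissae with sum greater than `t`. -/
def Advances (x y : X → ℝ) (D : X → X → ℝ → Prop) (a b : X) (t : ℝ) : Prop :=
  D a b (corridorBound x y a b) ∨ ∃ h l e r r', Front x y D a b h l e r r' ∧ t < x h + x l

lemma Front.neg_snd {e r r' : ℝ} (F : Front x y D a b h l e r r') :
    Front x (-y) D a b l h e r' r where
  above := F.below.neg_snd
  below := F.above.neg_snd
  east_le := F.east_le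
  north := by simpa only [Pi.neg_apply, neg_sub_neg] using F.south
  south := by simpa only [Pi.neg_apply, neg_sub_neg] using F.north
  empty := by simpa only [Pi.neg_apply, neg_sub_neg] using F.empty.neg_snd
  path_north := F.path_south
  path_south := F.path_north
  potential := by
    simp only [Pi.neg_apply, neg_sub_neg]
    linarith [F.potential]
  north_le := by simpa only [Pi.neg_apply, neg_sub_neg] using F.south_le
  south_le := by simpa only [Pi.neg_apply, neg_sub_neg] using F.north_le

lemma Advances.of_neg_snd {t : ℝ} (h : Advances x (-y) D a b t) : Advances x y D a b t := by
  rcases h with h | ⟨h, l, e, r, r', F, ht⟩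
  · exact .inl (corridorBound_neg_snd (y := y) ▸ h)
  · exact .inr ⟨l, h, e, r', r, by simpa only [neg_neg] using F.neg_snd, by rwa [add_comm]⟩

namespace Corridor

variable {p : X} {r r' w e s n t : ℝ}

lemma front_of_top (C : Corridor x y D a b) (F : Front x y D a b h l w r r')
    (S : EmptySquare x y (x h) e (y l) (y p)) (he : e ≤ x b) (hwe : w ≤ e) (hhl : x h ≤ x l)
    (hhp : x h < x p) (hpe : x p < e) (hyp : y h ≤ y p) :
    Front x y D a b p l e (r + (x p - x h + (y p - y h))) r' where
  above := ⟨F.above.west.trans hhp, hpe.trans_le he, F.above.left.trans_le hyp,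
    F.above.right.trans_le hyp⟩
  below := F.below
  east_le := he
  north := ⟨by linarith [S.side_eq], hpe.le⟩
  south := ⟨by linarith [S.side_eq], F.south.2.trans hwe⟩
  empty := S.empty.mono (by linarith [S.side_eq]) le_rfl le_rfl le_rfl
  path_north := C.net.trans F.path_north
    (C.net.edge_up S (.of_left rfl S.lt.le (F.below.left.trans F.above.left).le hyp)
      (.of_top rfl (by linarith [S.side_eq, S.lt]) hhp.le hpe.le) hhp.le hyp)
  path_south := F.path_south
  potential := by linarith [F.potential, S.side_eq, F.north.1]
  north_le := by linarith [F.north_le]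
  south_le := F.south_le

variable [Finite X]

lemma advances_of_above (C : Corridor x y D a b) (hp : Above x y a b p) (hl : Below x y a b l)
    (S : EmptySquare x y w (x p) s n) (hpS : OnBoundary x y w (x p) s n p)
    (hlS : OnBoundary x y w (x p) s n l) (path_p : D a p r) (path_l : D a l r')
    (hr : r ≤ 2 * (x p - x a)) (hr' : r' ≤ 2 * (x l - x a) + (y a - y l))
    (potential : r + r' + ((x p - x l) + (y p - y l)) ≤ 4 * (x p - x a)) (ht : t < x p + x l) :
    Advances x y D a b t := by
  have hpS_snd := hpS.2.1
  have hlS_snd := hlS.2.1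
  rcases le_or_gt (y p - y l) (x p - x l) with gentle | steep
  · exact .inl (C.path_of_gentle hp hl S hpS hlS gentle path_l hr')
  · refine .inr ⟨p, l, x p, r, r', ?_, ht⟩
    exact {
      above := hp
      below := hl
      east_le := hp.east.le
      north := ⟨by linarith [hp.left, hl.left], le_rfl⟩
      south := ⟨by linarith, hlS.1.2⟩
      empty := S.empty.mono (by linarith [S.side_eq]) le_rfl hlS_snd.1 hpS_snd.2
      path_north := path_p
      path_south := path_l
      potential := by linarith
      north_le := by linarith [hp.left]
      south_le := hr' }

lemma advances_of_east (C : Corridor x y D a b) (F : Front x y D a b h l e r r')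
    (hpb : x p ≤ x b) (hhp : x h < x p) (hlp : x l < x p) (S : EmptySquare x y w (x p) s n)
    (hhS : OnBoundary x y w (x p) s n h) (hlS : OnBoundary x y w (x p) s n l)
    (hpS : OnBoundary x y w (x p) s n p)
    (potential : r + (x p - x h + |y p - y h|) + (r' + (x p - x l + |y p - y l|)) ≤
      4 * (x p - x a)) :
    Advances x y D a b (x h + x l) := by
  have path_hp := C.net.trans F.path_north (C.net.edge_right S hhS hpS hhp.le)
  have path_lp := C.net.trans F.path_south (C.net.edge_right S hlS hpS hlp.le)
  obtain ⟨c, path_p, hch, hcl⟩ : ∃ c, D a p c ∧ c ≤ r + (x p - x h + |y p - y h|) ∧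
      c ≤ r' + (x p - x l + |y p - y l|) :=
    (le_total _ _).elim (fun hle => ⟨_, path_hp, le_rfl, hle⟩) fun hle => ⟨_, path_lp, hle, le_rfl⟩
  have hc : c ≤ 2 * (x p - x a) := by linarith
  rcases eq_or_ne p b with rfl | hne
  · refine .inl (C.net.mono path_p (hc.trans ?_))
    exact (le_add_of_nonneg_right (abs_nonneg _)).trans (two_mul_add_abs_le_corridorBound C.lt.le)
  rcases C.sides p (F.above.west.trans hhp) (hpb.lt_of_ne (C.net.injective_fst.ne hne)) with hp | hp
  · refine C.advances_of_above hp F.below S hpS hlS path_p F.path_south hc F.south_le ?_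
      (by linarith)
    grind
  · refine (C.neg_snd.advances_of_above hp.neg_snd F.above.neg_snd S.neg_snd hpS.neg_snd
      hhS.neg_snd path_p F.path_north hc F.neg_snd.south_le ?_ (by linarith)).of_neg_snd
    simp only [Pi.neg_apply, neg_sub_neg]
    grind

/-- Keeping `h` on the left side and `l` on the bottom side, the square grows until it hits a point
on its right or top side. -/
lemma advances_of_far (C : Corridor x y D a b) (F : Front x y D a b h l e r r') (hhl : x h ≤ x l)
    (far : EmptyBox x y (x h) (x h + (y h - y l)) (y l) (y h)) :
    Advances x y D a b (x h + x l) := by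
  have hb : x h + (y h - y l) ≤ x b := by
    by_contra! hb
    exact far b F.above.east hb F.below.right F.above.right
  obtain ⟨q, d, ⟨hq_west, hq_south⟩, hd, S, hd_min⟩ := exists_emptySquare_of_quadrant
    (x := x) (y := y) (w := x h) (s := y l) ⟨b, F.above.east, F.below.right⟩
  have hdb : x h + d ≤ x b := by
    have := hd_min b F.above.east F.below.right
    grind [F.above.right]
  have hd_ge : y h - y l ≤ d := by
    by_contra! hlt
    exact far q hq_west (by grind) hq_south (by grind)
  have hed : e ≤ x h + d := by linarith [F.north.1]
  rcases (show x q ≤ x h + d by grind).eq_or_lt with hqd | hqd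
  · rw [← hqd] at S
    have hlq : x l < x q := (F.south.2.trans (hqd ▸ hed)).lt_of_ne
      (C.net.injective_fst.ne fun hlq => hq_south.ne (congrArg y hlq))
    refine C.advances_of_east F (hqd.trans_le hdb) hq_west hlq S
      (.of_left rfl S.lt.le (by linarith [F.above.left, F.below.left]) (by linarith))
      (.of_bottom rfl (by linarith [S.lt]) hhl hlq.le)
      (.of_right rfl S.lt.le hq_south.le (by grind)) ?_
    grind [F.potential, F.north.1]
  · have hqn : y l + d = y q := by grind
    rw [hqn] at S
    exact .inr ⟨q, l, x h + d, _, r', C.front_of_top F S hdb hed hhl hq_west hqd (by linarith),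
      by linarith⟩

/-- The square slides to the right until it hits a point. If it would lose `h` before, it has
to grow instead. -/
lemma advances_of_le (C : Corridor x y D a b) (F : Front x y D a b h l e r r') (hhl : x h ≤ x l) :
    Advances x y D a b (x h + x l) := by
  obtain ⟨p, ⟨hpl, hph, hep⟩, hp_min⟩ := Set.exists_min_image
    {q | y l < y q ∧ y q < y h ∧ e ≤ x q} x (Set.toFinite _)
    ⟨b, F.below.right, F.above.right, F.east_le⟩
  have hpb : x p ≤ x b := hp_min b ⟨F.below.right, F.above.right, F.east_le⟩
  have empty : EmptyBox x y (e - (y h - y l)) (x p) (y l) (y h) := by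
    intro q hw he hs hn
    rcases lt_or_ge (x q) e with hqe | hqe
    · exact F.empty q hw hqe hs hn
    · exact he.not_ge (hp_min q ⟨hs, hn, hqe⟩)
  obtain ⟨hh_west, hh_east⟩ := F.north
  have hl_east := F.south.2
  rcases lt_or_ge (x h + (y h - y l)) (x p) with far | near
  · exact C.advances_of_far F hhl (empty.mono hh_west far.le le_rfl le_rfl)
  · have hhp : x h < x p := (hh_east.trans hep).lt_of_ne (C.net.injective_fst.ne (by grind))
    have hlp : x l < x p := (hl_east.trans hep).lt_of_ne (C.net.injective_fst.ne (by grind))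
    have S : EmptySquare x y (x p - (y h - y l)) (x p) (y l) (y h) :=
      ⟨by linarith, by ring, empty.mono (by linarith) le_rfl le_rfl le_rfl⟩
    refine C.advances_of_east F hpb hhp hlp S (.of_top rfl (by linarith) (by linarith) hhp.le)
      (.of_bottom rfl (by linarith) (by linarith) hlp.le)
      (.of_right rfl (by linarith) hpl.le hph.le) ?_
    grind [F.potential]

lemma advances (C : Corridor x y D a b) (F : Front x y D a b h l e r r') :
    Advances x y D a b (x h + x l) := by
  rcases le_total (x h) (x l) with hhl | hlh
  · exact C.advances_of_le F hhl
  · rw [add_comm]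
    exact (C.neg_snd.advances_of_le F.neg_snd hlh).of_neg_snd

lemma path_of_front (C : Corridor x y D a b) (F : Front x y D a b h l e r r') :
    D a b (corridorBound x y a b) := by
  refine exists_or_of_ascent (p := fun i : X × X => ∃ e r r', Front x y D a b i.1 i.2 e r r')
    (fun i => x i.1 + x i.2) ⟨(h, l), e, r, r', F⟩ fun i ⟨e, r, r', F⟩ => ?_
  exact (C.advances F).imp_right fun ⟨h, l, e, r, r', F, ht⟩ => ⟨(h, l), ⟨e, r, r', F⟩, ht⟩

end Corridor

/-! ### The first square of a corridor -/

/-- The side length of the smallest square with left side on the vertical line through `a` that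
reaches as far right as `h` and `l` and as high as the vertical distance between them. -/
noncomputable def reach (x y : X → ℝ) (a h l : X) : ℝ :=
  max (max (x h - x a) (x l - x a)) (y h - y l)

lemma reach_neg_snd : reach x (-y) a l h = reach x y a h l := by
  rw [reach, reach, max_comm (x l - x a), Pi.neg_apply, Pi.neg_apply, neg_sub_neg]

/-- The points `h` above and `l` below the corridor have the smallest possible `reach`, namely `k`,
and they are the lowest and the highest such point at horizontal distance at most `k` from `a`. -/
structure NarrowestPair (x y : X → ℝ) (a b h l : X) (k : ℝ) : Prop where
  above : Above x y a b h
  below : Below x y a b l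
  reach_eq : reach x y a h l = k
  lowest (q : X) : Above x y a b q → x q ≤ x a + k → y h ≤ y q
  highest (q : X) : Below x y a b q → x q ≤ x a + k → y q ≤ y l
  le_reach (q q' : X) : Above x y a b q → Below x y a b q' → k ≤ reach x y a q q'

lemma NarrowestPair.neg_snd {k : ℝ} (H : NarrowestPair x y a b h l k) :
    NarrowestPair x (-y) a b l h k where
  above := H.below.neg_snd
  below := H.above.neg_snd
  reach_eq := reach_neg_snd.trans H.reach_eq
  lowest q hq hqk := neg_le_neg (H.highest q (by simpa only [neg_neg] using hq.neg_snd) hqk)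
  highest q hq hqk := neg_le_neg (H.lowest q (by simpa only [neg_neg] using hq.neg_snd) hqk)
  le_reach q q' hq hq' := reach_neg_snd.symm ▸ H.le_reach q' q
    (by simpa only [neg_neg] using hq'.neg_snd) (by simpa only [neg_neg] using hq.neg_snd)

lemma exists_narrowestPair [Finite X] (hh : Above x y a b h) (hl : Below x y a b l) :
    ∃ h' l' k, NarrowestPair x y a b h' l' k ∧ k ≤ reach x y a h l := by
  obtain ⟨⟨h₀, l₀⟩, ⟨hh₀, hl₀⟩, hk⟩ := Set.exists_min_image
    {i : X × X | Above x y a b i.1 ∧ Below x y a b i.2} (fun i => reach x y a i.1 i.2)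
    (Set.toFinite _) ⟨(h, l), hh, hl⟩
  have le_reach (q q' : X) (hq : Above x y a b q) (hq' : Below x y a b q') :
    reach x y a h₀ l₀ ≤ reach x y a q q' := hk (q, q') ⟨hq, hq'⟩
  obtain ⟨k, hk⟩ : ∃ k, k = reach x y a h₀ l₀ := ⟨_, rfl⟩
  rw [← hk] at le_reach
  rw [reach] at hk
  obtain ⟨h', ⟨hh', hh'k⟩, lowest⟩ := Set.exists_min_image {q | Above x y a b q ∧ x q ≤ x a + k} y
    (Set.toFinite _) ⟨h₀, hh₀, by grind⟩
  obtain ⟨l', ⟨hl', hl'k⟩, highest⟩ := Set.exists_max_image {q | Below x y a b q ∧ x q ≤ x a + k} y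
    (Set.toFinite _) ⟨l₀, hl₀, by grind⟩
  have hyh : y h' ≤ y h₀ := lowest h₀ ⟨hh₀, by grind⟩
  have hyl : y l₀ ≤ y l' := highest l₀ ⟨hl₀, by grind⟩
  refine ⟨h', l', k, ⟨hh', hl', ?_, fun q hq hqk => lowest q ⟨hq, hqk⟩,
    fun q hq hqk => highest q ⟨hq, hqk⟩, le_reach⟩, le_reach h l hh hl⟩
  refine le_antisymm ?_ (le_reach h' l' hh' hl')
  exact max_le (max_le (by linarith) (by linarith)) (by grind)

namespace Corridor

variable {e s n k : ℝ}

lemma front_of_emptySquare (C : Corridor x y D a b) (hh : Above x y a b h) (hl : Below x y a b l)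
    (S : EmptySquare x y (x a) e s n) (hhS : OnBoundary x y (x a) e s n h)
    (hlS : OnBoundary x y (x a) e s n l) (he : e ≤ x b) (hh_west : e - (y h - y l) ≤ x h)
    (hl_west : e - (y h - y l) ≤ x l) :
    Front x y D a b h l e (x h - x a + (y h - y a)) (x l - x a + (y a - y l)) := by
  have hs : s ≤ y l := hlS.2.1.1
  have hn : y h ≤ n := hhS.2.1.2
  have haS : OnBoundary x y (x a) e s n a :=
    .of_left rfl S.lt.le (hs.trans hl.left.le) (hh.left.le.trans hn)
  exact {
    above := hh
    below := hl
    east_le := he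
    north := ⟨hh_west, hhS.1.2⟩
    south := ⟨hl_west, hlS.1.2⟩
    empty := S.empty.mono (by linarith [S.side_eq]) le_rfl hs hn
    path_north := C.net.edge_up S haS hhS hh.west.le hh.left.le
    path_south := C.net.edge_down S haS hlS hl.west.le hl.left.le
    potential := by linarith [S.side_eq]
    north_le := by linarith [hh.west]
    south_le := by linarith [hl.west] }

/-- If the points above and those below the corridor are far apart, then a square with left side
through `a` and right side through `b` fits between them. -/
lemma path_of_wide (C : Corridor x y D a b)
    (wide : ∀ h l, Above x y a b h → Below x y a b l → x b - x a ≤ y h - y l) :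
    D a b (corridorBound x y a b) := by
  have slope := C.slope
  obtain ⟨t, hst, htu⟩ := exists_between_of_forall_le
    (s := insert (max (y a) (y b) - (x b - x a)) (y '' {q | Below x y a b q}))
    (t := insert (min (y a) (y b)) ((y · - (x b - x a)) '' {q | Above x y a b q}))
    (Set.insert_nonempty _ _) (Set.insert_nonempty _ _) (by
      rintro _ (rfl | ⟨l, hl, rfl⟩) _ (rfl | ⟨h, hh, rfl⟩)
      · grind
      · grind [hh.left, hh.right]
      · grind [hl.left, hl.right]
      · linarith [wide h l hh hl])
  have ht_low : max (y a) (y b) - (x b - x a) ≤ t := hst (.inl rfl)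
  have ht_high : t ≤ min (y a) (y b) := htu (.inl rfl)
  have S : EmptySquare x y (x a) (x b) t (t + (x b - x a)) := by
    refine ⟨C.lt, by ring, fun q hw he hs hn => ?_⟩
    rcases C.sides q hw he with hq | hq
    · linarith [htu (.inr ⟨q, hq, rfl⟩)]
    · linarith [hst (.inr ⟨q, hq, rfl⟩)]
  refine C.net.mono (C.net.edge_right S (.of_left rfl C.lt.le (by grind) (by grind))
    (.of_right rfl C.lt.le (by grind) (by grind)) C.lt.le) ?_
  linarith [two_mul_add_abs_le_corridorBound (y := y) C.lt.le, C.lt]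

variable [Finite X]

lemma path_of_reach_eq_snd (C : Corridor x y D a b) (H : NarrowestPair x y a b h l k)
    (hkb : k ≤ x b - x a) (hk : k = y h - y l) : D a b (corridorBound x y a b) := by
  have hk_pos : 0 < k := by linarith [H.above.left, H.below.left]
  have hkh : x h - x a ≤ k := by grind [reach, H.reach_eq]
  have hkl : x l - x a ≤ k := by grind [reach, H.reach_eq]
  have S : EmptySquare x y (x a) (x a + k) (y l) (y h) := by
    refine ⟨by linarith, by linarith, fun q hw he hs hn => ?_⟩
    rcases C.sides q hw (by linarith) with hq | hq
    · exact hn.not_ge (H.lowest q hq he.le)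
    · exact hs.not_ge (H.highest q hq he.le)
  exact C.path_of_front (C.front_of_emptySquare H.above H.below S
    (.of_top rfl (by linarith) H.above.west.le (by linarith))
    (.of_bottom rfl (by linarith) H.below.west.le (by linarith)) (by linarith)
    (by linarith [H.above.west]) (by linarith [H.below.west]))

lemma path_of_reach_eq_fst (C : Corridor x y D a b) (H : NarrowestPair x y a b h l k)
    (hk : k = x l - x a) : D a b (corridorBound x y a b) := by
  have hk_snd : y h - y l ≤ k := by grind [reach, H.reach_eq]
  have hhl : x h < x l := lt_of_le_of_ne (by grind [reach, H.reach_eq])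
    (C.net.injective_fst.ne (by grind [H.above.left, H.below.left]))
  have S : EmptySquare x y (x a) (x l) (y h - k) (y h) := by
    refine ⟨H.below.west, by linarith, fun q hw he hs hn => ?_⟩
    rcases C.sides q hw (he.trans H.below.east) with hq | hq
    · exact hn.not_ge (H.lowest q hq (by linarith))
    · have := H.le_reach h q H.above hq
      grind [reach]
  have hhS : OnBoundary x y (x a) (x l) (y h - k) (y h) h :=
    .of_top rfl (by linarith [H.below.west]) H.above.west.le hhl.le
  have hlS : OnBoundary x y (x a) (x l) (y h - k) (y h) l :=
    .of_right rfl S.lt.le (by linarith) (by linarith [H.above.left, H.below.left])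
  rcases le_or_gt (x l - (y h - y l)) (x h) with hh_west | gentle
  · exact C.path_of_front (C.front_of_emptySquare H.above H.below S hhS hlS H.below.east.le hh_west
      (by linarith [H.above.left, H.below.left]))
  · have haS : OnBoundary x y (x a) (x l) (y h - k) (y h) a :=
      .of_left rfl S.lt.le (by linarith [H.below.left]) H.above.left.le
    rw [← corridorBound_neg_snd]
    refine C.neg_snd.path_of_gentle H.below.neg_snd H.above.neg_snd S.neg_snd hlS.neg_snd
      hhS.neg_snd ?_ (C.net.edge_up S haS hhS H.above.west.le H.above.left.le) ?_ <;>
    simp only [Pi.neg_apply, neg_sub_neg] <;> linarith [H.above.west]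

lemma path_of_narrowestPair (C : Corridor x y D a b) (H : NarrowestPair x y a b h l k)
    (hkb : k ≤ x b - x a) : D a b (corridorBound x y a b) := by
  rcases max_choice (max (x h - x a) (x l - x a)) (y h - y l) with hk | hk
  · rcases max_choice (x h - x a) (x l - x a) with hk' | hk'
    · rw [← corridorBound_neg_snd]
      exact C.neg_snd.path_of_reach_eq_fst H.neg_snd (H.reach_eq.symm.trans (hk.trans hk'))
    · exact C.path_of_reach_eq_fst H (H.reach_eq.symm.trans (hk.trans hk'))
  · exact C.path_of_reach_eq_snd H hkb (H.reach_eq.symm.trans hk)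

lemma path (C : Corridor x y D a b) : D a b (corridorBound x y a b) := by
  by_cases! wide : ∀ h l, Above x y a b h → Below x y a b l → x b - x a ≤ y h - y l
  · exact C.path_of_wide wide
  · obtain ⟨h₀, l₀, hh₀, hl₀, hlt⟩ := wide
    obtain ⟨h, l, k, H, hk⟩ := exists_narrowestPair hh₀ hl₀
    exact C.path_of_narrowestPair H (hk.trans
      (max_le (max_le (by linarith [hh₀.east]) (by linarith [hl₀.east])) hlt.le))

end Corridor

/-! ### Induction on the `L_∞`-distance -/

lemma pathBound_neg : pathBound (-x) (-y) u v = pathBound x y u v := by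
  rw [pathBound_neg_snd, ← pathBound_swap, pathBound_neg_snd, pathBound_swap]

lemma PathBoundBelow.neg {δ : ℝ} (h : PathBoundBelow x y D δ) : PathBoundBelow (-x) (-y) D δ :=
  h.swap.neg_snd.swap.neg_snd

/-- The point `c` lies in the open rectangle with lower left corner `a` and upper right corner
`b`. -/
structure Between (x y : X → ℝ) (a b c : X) : Prop where
  west : x a < x c
  east : x c < x b
  south : y a < y c
  north : y c < y b

namespace Net

/-- The square that grows from its lower left corner `a` hits a point within the height of the
rectangle. Both coordinates increase along the resulting edge, so the `√2` term of the bound is left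
for the rest of the path. -/
lemma path_of_between_of_left_le [Finite X] {c : X} (N : Net x y D)
    (ih : PathBoundBelow x y D (x b - x a)) (slope : y b - y a ≤ x b - x a)
    (hc : Between x y a b c) (near : x c - x a ≤ y b - y a) : D a b (pathBound x y a b) := by
  obtain ⟨q, d, ⟨hwq, hsq⟩, hd, S, hd_min⟩ :=
    exists_emptySquare_of_quadrant (x := x) (y := y) ⟨c, hc.west, hc.south⟩
  have hdy : d ≤ y b - y a :=
    (hd_min c hc.west hc.south).trans (max_le near (by linarith [hc.north]))
  have path_aq : D a q (x q - x a + (y q - y a)) := by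
    refine N.edge_up S (.of_left rfl S.lt.le le_rfl (by linarith [S.lt])) ?_ hwq.le hsq.le
    rcases max_choice (x q - x a) (y q - y a) with h | h
    · exact .of_right (by linarith) S.lt.le hsq.le (by grind)
    · exact .of_top (by linarith) (by linarith [S.lt]) hwq.le (by grind)
  rw [pathBound_of_abs_le (by grind [hc.south, hc.north]),
    abs_of_pos (by linarith [hc.south, hc.north])]
  rcases eq_or_ne q b with rfl | hne
  · exact N.mono path_aq (by nlinarith [Real.sqrt_nonneg 2])
  · have hqx : x q < x b := (by grind : x q ≤ x b).lt_of_ne (N.injective_fst.ne hne)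
    have hqy : y q < y b := (by grind : y q ≤ y b).lt_of_ne (N.injective_snd.ne hne)
    have path_qb : D q b (pathBound x y q b) := ih q b (by grind) (by grind)
    refine N.mono (N.trans path_aq path_qb) ?_
    have hmax : √2 * max |x q - x b| |y q - y b| ≤ √2 * (x b - x a) := by gcongr; grind
    rw [pathBound, abs_of_neg (sub_neg.mpr hqx), abs_of_neg (sub_neg.mpr hqy)] at *
    linarith

lemma path_of_between [Finite X] {c : X} (N : Net x y D)
    (ih : PathBoundBelow x y D (x b - x a)) (slope : y b - y a ≤ x b - x a)
    (hc : Between x y a b c) :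
    D a b (pathBound x y a b) := by
  rcases le_or_gt (x c - x a) (y b - y a) with left_near | left_far
  · exact N.path_of_between_of_left_le ih slope hc left_near
  rcases le_or_gt (x b - x c) (y b - y a) with right_near | right_far
  · have path_ba := N.neg.path_of_between_of_left_le (a := b) (b := a) (c := c)
      (by simpa only [Pi.neg_apply, neg_sub_neg] using ih.neg)
      (by simpa only [Pi.neg_apply, neg_sub_neg] using slope)
      ⟨neg_lt_neg hc.east, neg_lt_neg hc.west, neg_lt_neg hc.north, neg_lt_neg hc.south⟩
      (by simpa only [Pi.neg_apply, neg_sub_neg] using right_near)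
    rw [pathBound_neg, pathBound_comm] at path_ba
    exact N.symm path_ba
  · obtain ⟨west, east, south, north⟩ := hc
    have path_ac : D a c (pathBound x y a c) := ih a c (by grind) (by grind)
    have path_cb : D c b (pathBound x y c b) := ih c b (by grind) (by grind)
    refine N.mono (N.trans path_ac path_cb) ?_
    rw [pathBound_of_abs_le (by grind), pathBound_of_abs_le (by grind),
      pathBound_of_abs_le (by grind), abs_of_pos (by linarith : 0 < y c - y a),
      abs_of_pos (by linarith : 0 < y b - y c), abs_of_pos (by linarith : 0 < y b - y a)]
    linarith

lemma path_of_slope_le [Finite X] (N : Net x y D) (ih : PathBoundBelow x y D (x b - x a))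
    (lt : x a < x b) (slope : |y b - y a| ≤ x b - x a) :
    D a b (pathBound x y a b) := by
  by_cases hup : ∃ c, Between x y a b c
  · obtain ⟨c, hc⟩ := hup
    exact N.path_of_between ih ((le_abs_self _).trans slope) hc
  by_cases hdown : ∃ c, Between x (-y) a b c
  · obtain ⟨c, hc⟩ := hdown
    rw [← pathBound_neg_snd]
    refine N.neg_snd.path_of_between ih.neg_snd ?_ hc
    rw [Pi.neg_apply, Pi.neg_apply, neg_sub_neg, ← neg_sub]
    exact (neg_le_abs _).trans slope
  rw [pathBound_of_abs_le slope]
  refine Corridor.path ⟨N, lt, slope, fun q hw he => ?_, ih⟩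
  have hqa : y q ≠ y a := N.injective_snd.ne (by grind)
  have hqb : y q ≠ y b := N.injective_snd.ne (by grind)
  by_contra hq
  rcases hqa.lt_or_gt with hqa | hqa <;> rcases hqb.lt_or_gt with hqb | hqb
  · exact hq (.inr ⟨hw, he, hqa, hqb⟩)
  · exact hdown ⟨q, hw, he, neg_lt_neg hqa, neg_lt_neg hqb⟩
  · exact hup ⟨q, hw, he, hqa, hqb⟩
  · exact hq (.inl ⟨hw, he, hqa, hqb⟩)

lemma path_of_abs_le [Finite X] (N : Net x y D) (ih : PathBoundBelow x y D |x u - x v|)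
    (hne : u ≠ v) (slope : |y u - y v| ≤ |x u - x v|) : D u v (pathBound x y u v) := by
  rcases (N.injective_fst.ne hne).lt_or_gt with hlt | hlt
  · rw [abs_sub_comm (x u), abs_of_pos (sub_pos.mpr hlt)] at ih slope
    exact N.path_of_slope_le ih hlt (by rwa [abs_sub_comm])
  · rw [abs_of_pos (sub_pos.mpr hlt)] at ih slope
    rw [pathBound_comm]
    exact N.symm (N.path_of_slope_le ih hlt slope)

theorem path [Finite X] (N : Net x y D) (u v : X) : D u v (pathBound x y u v) := by
  by_contra hbad
  obtain ⟨⟨u, v⟩, huv, huv_min⟩ := Set.exists_min_image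
    {p : X × X | ¬ D p.1 p.2 (pathBound x y p.1 p.2)}
    (fun p => max |x p.1 - x p.2| |y p.1 - y p.2|) (Set.toFinite _) ⟨(u, v), hbad⟩
  have ih : PathBoundBelow x y D (max |x u - x v| |y u - y v|) := by
    intro u' v' hx hy
    by_contra hbad
    exact (huv_min (u', v') hbad).not_gt (max_lt hx hy)
  rcases eq_or_ne u v with rfl | hne
  · exact huv (by simpa [pathBound] using N.self u)
  rcases le_total |y u - y v| |x u - x v| with h | h
  · rw [max_eq_left h] at ih
    exact huv (N.path_of_abs_le ih hne h)
  · rw [max_eq_right h] at ih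
    have path_uv := N.swap.path_of_abs_le ih.swap hne h
    rw [pathBound_swap] at path_uv
    exact huv path_uv

end Net

lemma pathBound_le_mul_sqrt :
    pathBound x y u v ≤ √(4 + 2 * √2) * √((x u - x v) ^ 2 + (y u - y v) ^ 2) := by
  have linear_le (s t : ℝ) : s + t + √2 * s ≤ √(4 + 2 * √2) * √(s ^ 2 + t ^ 2) := by
    rw [← Real.sqrt_mul (by positivity)]
    refine Real.le_sqrt_of_sq_le ?_
    -- The Cauchy–Schwarz inequality for `(1 + √2, 1)` and `(s, t)`.
    nlinarith [sq_nonneg (s - (1 + √2) * t), Real.sq_sqrt (zero_le_two (α := ℝ))]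
  rw [pathBound, ← sq_abs (x u - x v), ← sq_abs (y u - y v)]
  rcases le_total |y u - y v| |x u - x v| with h | h
  · rw [max_eq_left h]
    exact linear_le _ _
  · rw [max_eq_right h, add_comm |x u - x v|, add_comm (|x u - x v| ^ 2)]
    exact linear_le _ _

/-! ### Delaunay triangulations -/

/-- Cartesian coordinates `x` and `y` in which the squares of the distance `d` are parallel to the
axes, those of size `r` having sides of length `2 * r / k`. -/
structure SquareCoordinates (d : Plane → Plane → ℝ) (x y : Plane → ℝ) (k : ℝ) : Prop where
  pos : 0 < k
  surjective (s t : ℝ) : ∃ p, x p = s ∧ y p = t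
  dist_eq (u v : Plane) : dist u v = √((x u - x v) ^ 2 + (y u - y v) ^ 2)
  eq_mul_max (u v : Plane) : d u v = k * max |x u - x v| |y u - y v|

/-- The points `u` and `v` have distance at most `r` in `G`. -/
def GraphDistLE {P : Finset Plane} (G : SimpleGraph P) (u v : P) (r : ℝ) : Prop :=
  0 ≤ r ∧ graphDist G u v ≤ ENNReal.ofReal r

section Delaunay

variable {P : Finset Plane} {d : Plane → Plane → ℝ} {x y : Plane → ℝ} {k : ℝ}

lemma OnBoundary.max_abs_sub_eq {X : Type*} {x y : X → ℝ} {w e s n : ℝ} {p : X}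
    (h : OnBoundary x y w e s n p) (side_eq : e - w = n - s) :
    max |x p - (w + e) / 2| |y p - (s + n) / 2| = (e - w) / 2 := by
  obtain ⟨hx, hy, hp⟩ := h
  grind

lemma SquareCoordinates.delaunay_adj (S : SquareCoordinates d x y k) {w e s n : ℝ} {u v : P}
    (hS : EmptySquare (fun p : P => x p) (fun p => y p) w e s n)
    (hu : OnBoundary (fun p : P => x p) (fun p => y p) w e s n u)
    (hv : OnBoundary (fun p : P => x p) (fun p => y p) w e s n v) (hne : u ≠ v) :
    (delaunay d P).Adj u v := by
  obtain ⟨c, hcx, hcy⟩ := S.surjective ((w + e) / 2) ((s + n) / 2)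
  have mem_boundary (p : P) (hp : OnBoundary (fun p : P => x p) (fun p => y p) w e s n p) :
      d p c = k * ((e - w) / 2) := by
    rw [S.eq_mul_max, hcx, hcy, hp.max_abs_sub_eq hS.side_eq]
  refine ⟨hne, c, k * ((e - w) / 2), mul_pos S.pos (by linarith [hS.lt]), mem_boundary u hu,
    mem_boundary v hv, fun q hq hlt => ?_⟩
  rw [squareInterior, Set.mem_ofPred_eq, S.eq_mul_max, hcx, hcy, mul_lt_mul_iff_right₀ S.pos,
    max_lt_iff, abs_lt, abs_lt] at hlt
  have side_eq := hS.side_eq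
  exact hS.empty ⟨q, hq⟩ (by linarith) (by linarith) (by linarith) (by linarith)

lemma SquareCoordinates.net (S : SquareCoordinates d x y k)
    (hP : ∀ u ∈ P, ∀ v ∈ P, u ≠ v → x u ≠ x v ∧ y u ≠ y v) :
    Net (fun p : P => x p) (fun p => y p) (GraphDistLE (delaunay d P)) where
  injective_fst u v huv := by
    by_contra hne
    exact (hP u u.2 v v.2 (Subtype.coe_ne_coe.mpr hne)).1 huv
  injective_snd u v huv := by
    by_contra hne
    exact (hP u u.2 v v.2 (Subtype.coe_ne_coe.mpr hne)).2 huv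
  self u := ⟨le_rfl, by simp [graphDist_self]⟩
  mono h hr := ⟨h.1.trans hr, h.2.trans (ENNReal.ofReal_le_ofReal hr)⟩
  symm h := ⟨h.1, (graphDist_comm _ _).trans_le h.2⟩
  trans {u v w r r'} h h' := by
    refine ⟨add_nonneg h.1 h'.1, (graphDist_triangle u v w).trans ?_⟩
    rw [ENNReal.ofReal_add h.1 h'.1]
    exact add_le_add h.2 h'.2
  edge {u v _ _ _ _} hS hu hv := by
    refine ⟨Real.sqrt_nonneg _, ?_⟩
    rw [← S.dist_eq, ← edist_dist]
    rcases eq_or_ne u v with rfl | hne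
    · simp [graphDist_self]
    · exact graphDist_le_edist_of_adj (S.delaunay_adj hS hu hv hne)

lemma SquareCoordinates.stretchFactor_delaunay_le (S : SquareCoordinates d x y k)
    (hP : ∀ u ∈ P, ∀ v ∈ P, u ≠ v → x u ≠ x v ∧ y u ≠ y v) :
    stretchFactor (delaunay d P) ≤ ENNReal.ofReal √(4 + 2 * √2) := by
  refine stretchFactor_le_of_graphDist_le fun u v => ((S.net hP).path u v).2.trans ?_
  rw [edist_dist, ← ENNReal.ofReal_mul (Real.sqrt_nonneg _), S.dist_eq]
  exact ENNReal.ofReal_le_ofReal pathBound_le_mul_sqrt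

end Delaunay

lemma dist_eq_sqrt (u v : Plane) : dist u v = √((u 0 - v 0) ^ 2 + (u 1 - v 1) ^ 2) := by
  rw [EuclideanSpace.dist_eq, Fin.sum_univ_two, Real.dist_eq, Real.dist_eq, sq_abs, sq_abs]

lemma abs_add_abs_eq_max (s t : ℝ) : |s| + |t| = max |s + t| |s - t| := by
  grind

lemma squareCoordinates_distInf : SquareCoordinates distInf (fun u => u 0) (fun u => u 1) 1 where
  pos := one_pos
  surjective s t := ⟨!₂[s, t], rfl, rfl⟩
  dist_eq := dist_eq_sqrt
  eq_mul_max _ _ := (one_mul _).symm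

lemma squareCoordinates_distOne :
    SquareCoordinates distOne (fun u => (u 0 + u 1) / √2) (fun u => (u 0 - u 1) / √2) √2 where
  pos := by positivity
  surjective s t := by
    refine ⟨!₂[√2 * (s + t) / 2, √2 * (s - t) / 2], ?_, ?_⟩
    · change (√2 * (s + t) / 2 + √2 * (s - t) / 2) / √2 = s
      field_simp
      ring
    · change (√2 * (s + t) / 2 - √2 * (s - t) / 2) / √2 = t
      field_simp
      ring
  dist_eq u v := by
    rw [dist_eq_sqrt, ← sub_div, ← sub_div, div_pow, div_pow, Real.sq_sqrt zero_le_two]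
    ring_nf
  eq_mul_max u v := by
    have h : (0 : ℝ) < √2 := by positivity
    rw [← sub_div, ← sub_div, abs_div, abs_div, abs_of_pos h, max_div_div_right h.le,
      mul_div_cancel₀ _ h.ne', distOne, abs_add_abs_eq_max]
    ring_nf

theorem mainTheorem2_general (P : Finset Plane) :
    ((∀ u ∈ P, ∀ v ∈ P, u ≠ v → u 0 + u 1 ≠ v 0 + v 1 ∧ u 0 - u 1 ≠ v 0 - v 1) →
      stretchFactor (delaunayOne P) ≤ ENNReal.ofReal √(4 + 2 * √2)) ∧
    ((∀ u ∈ P, ∀ v ∈ P, u ≠ v → u 0 ≠ v 0 ∧ u 1 ≠ v 1) →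
      stretchFactor (delaunayInf P) ≤ ENNReal.ofReal √(4 + 2 * √2)) := by
  refine ⟨fun hP => squareCoordinates_distOne.stretchFactor_delaunay_le ?_,
    squareCoordinates_distInf.stretchFactor_delaunay_le⟩
  have h : √(2 : ℝ) ≠ 0 := by positivity
  simpa only [ne_eq, div_left_inj' h] using hP

end SquareDelaunay

theorem mainTheorem2 (P : Finset SquareDelaunay.Plane) :
    (SquareDelaunay.GeneralPositionOne P →
      SquareDelaunay.stretchFactor (SquareDelaunay.delaunayOne P) ≤
        ENNReal.ofReal (Real.sqrt (4 + 2 * Real.sqrt 2))) ∧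
    (SquareDelaunay.GeneralPositionInf P →
      SquareDelaunay.stretchFactor (SquareDelaunay.delaunayInf P) ≤
        ENNReal.ofReal (Real.sqrt (4 + 2 * Real.sqrt 2))) :=
  ⟨fun hP => (SquareDelaunay.mainTheorem2_general P).1 hP.2,
    fun hP => (SquareDelaunay.mainTheorem2_general P).2 hP.2⟩
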